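/- Let $H$ be a complex Hilbert space and let $V$ be a closed isometric operator in $H$, i.e. a closed linear operator with domain $D(V)\subseteq H$ and range $R(V)\subseteq H$ such that $\|Vh\|=\|h\|$ for all $h\in D(V)$. Put $N_0=H\ominus D(V)$ and $N_\infty=H\ominus R(V)$, and for a bounded linear operator $C:N_0\to N_\infty$ let $V\oplus C$ be the operator on $H=D(V)\oplus N_0$ which equals $V$ on $D(V)$ and $C$ on $N_0$. Let $\mathbb D=\{|z|<1\}$, $\mathbb D_e=\{|z|>1\}$, $\mathbb T=\{|z|=1\}$. Let $\mathbf R_z$ be an arbitrary generalized resolvent of $V$, that is, $\mathbf R_z h=P^{\widetilde H}_H(E_{\widetilde H}-zU)^{-1}h$ for $h\in H$, $|z|\neq 1$, where $U\supseteq V$ is a unitary operator in a Hilbert space $\widetilde H\supseteq H$ and $P^{\widetilde H}_H$ is the orthogonal projection of $\widetilde H$ onto $H$. Let $F$ be the function corresponding to $\mathbf R_z$ by Chumakin's formula: $F\in\mathcal S(N_0;N_\infty)$, i.e. $F$ is an analytic function in $\mathbb D$ whose values are linear contractions from $N_0$ into $N_\infty$, and $$\mathbf R_z=\bigl[E_H-z\,(V\oplus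 F(z))\bigr]^{-1},\qquad z\in\mathbb D.$$ Let $\Delta$ be an open arc of $\mathbb T$. Then $\mathbf R_z$ has an analytic continuation (as a function with values in the bounded operators on $H$) to $\mathbb D\cup\mathbb D_e\cup\Delta$ if and only if the following conditions are satisfied: 1) $F$ has an extension to $\mathbb D\cup\Delta$, with values in the bounded linear operators from $N_0$ to $N_\infty$, which is continuous in the uniform operator topology; 2) for all $\lambda\in\Delta$, the extended $F(\lambda)$ maps $N_0$ isometrically onto the whole $N_\infty$; 3) for all $\lambda\in\Delta$, the operator $\bigl(E_H-\lambda\,(V\oplus F(\lambda))\bigr)^{-1}$ exists and is defined on the whole $H$. -/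

import Mathlib

namespace IsometricGaps

/-- A closed isometric operator `V` in the Hilbert space `H`: a linear operator with domain
`D(V) ⊆ H` (not assumed dense), with closed graph, preserving the norm. -/
structure ClosedIsometricOperator (H : Type*) [NormedAddCommGroup H] [InnerProductSpace ℂ H] where
  /-- the underlying partially defined linear operator -/
  op : H →ₗ.[ℂ] H
  isClosed : op.IsClosed
  norm_map : ∀ x : op.domain, ‖op x‖ = ‖x‖

namespace ClosedIsometricOperator

variable {H : Type*} [NormedAddCommGroup H] [InnerProductSpace ℂ H]

/-- `V` as a linear isometry defined on its domain. -/
def isom (V : ClosedIsometricOperator H) : V.op.domain →ₗᵢ[ℂ] H where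
  toLinearMap := V.op.toFun
  norm_map' := V.norm_map

/-- The domain of a closed isometric operator in a Hilbert space is complete. -/
theorem completeSpace_domain [CompleteSpace H] (V : ClosedIsometricOperator H) :
    CompleteSpace V.op.domain := by
  have hc : IsClosed (V.op.domain : Set H) := by
    refine IsSeqClosed.isClosed ?_
    intro u x hu hx
    have hcau : CauchySeq (fun n => V.op ⟨u n, hu n⟩) := by
      have h1 : CauchySeq (fun n => (⟨u n, hu n⟩ : V.op.domain)) :=
        by
        have h0 := Metric.cauchySeq_iff.1 hx.cauchySeq
        exact Metric.cauchySeq_iff.2 h0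
      exact h1.map V.isom.isometry.uniformContinuous
    obtain ⟨y, hy⟩ := cauchySeq_tendsto_of_complete hcau
    have hg : (x, y) ∈ V.op.graph := by
      have hcl : IsClosed (V.op.graph : Set (H × H)) := V.isClosed
      refine hcl.mem_of_tendsto (hx.prodMk_nhds hy) (Filter.Eventually.of_forall fun n => ?_)
      exact V.op.mem_graph ⟨u n, hu n⟩
    obtain ⟨z, hz, -⟩ := (LinearPMap.mem_graph_iff _).1 hg
    have hz' : (z : H) = x := hz
    exact hz' ▸ z.2
  exact hc.completeSpace_coe

instance [CompleteSpace H] (V : ClosedIsometricOperator H) : CompleteSpace V.op.domain :=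
  V.completeSpace_domain

/-- The defect subspace `N_0 = H ⊖ D(V)`. -/
noncomputable abbrev defectZero (V : ClosedIsometricOperator H) : Submodule ℂ H :=
  V.op.domainᗮ

/-- The defect subspace `N_∞ = H ⊖ R(V)`. -/
noncomputable abbrev defectInfty (V : ClosedIsometricOperator H) : Submodule ℂ H :=
  (LinearMap.range V.op.toFun)ᗮ

/-- The orthogonal sum `V ⊕ C` for a bounded operator `C : N_0 → N_∞`: the bounded operator on
`H = D(V) ⊕ N_0` that acts as `V` on `D(V)` and as `C` on `N_0`. -/
noncomputable def oplus [CompleteSpace H] (V : ClosedIsometricOperator H)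
    (C : V.defectZero →L[ℂ] V.defectInfty) : H →L[ℂ] H :=
  V.isom.toContinuousLinearMap ∘L V.op.domain.orthogonalProjectionOnto +
    V.defectInfty.subtypeL ∘L C ∘L V.defectZero.orthogonalProjectionOnto

end ClosedIsometricOperator

/-- The class `𝒮(H₁; H₂)`: functions analytic in the open unit disc whose values are
linear contractions `H₁ → H₂` (values outside the disc are irrelevant). -/
structure IsSchurFunction {H₁ H₂ : Type*} [NormedAddCommGroup H₁] [NormedSpace ℂ H₁]
    [NormedAddCommGroup H₂] [NormedSpace ℂ H₂] (F : ℂ → H₁ →L[ℂ] H₂) : Prop where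
  analytic : AnalyticOnNhd ℂ F {z : ℂ | ‖z‖ < 1}
  contraction : ∀ z : ℂ, ‖z‖ < 1 → ∀ x : H₁, ‖F z x‖ ≤ ‖x‖

section GeneralizedResolvent

variable {H : Type*} [NormedAddCommGroup H] [InnerProductSpace ℂ H] [CompleteSpace H]
  {K : Type*} [NormedAddCommGroup K] [InnerProductSpace ℂ K] [CompleteSpace K]

/-- The unitary operator `U` in `K`, where `H` is regarded as a subspace of `K` by means of the
isometric embedding `ι`, extends `V`. -/
def IsUnitaryExtension (V : ClosedIsometricOperator H) (ι : H →ₗᵢ[ℂ] K) (U : K ≃ₗᵢ[ℂ] K) : Prop :=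
  ∀ x : V.op.domain, U (ι (x : H)) = ι (V.op x)

/-- The generalized resolvent `R_z h = P (E - z U)⁻¹ h`, `h ∈ H`, where `P` is the orthogonal
projection of `K` onto `H`; the adjoint of the embedding `ι` of `H` is `P` seen as a map into `H`.
It is used for `|z| ≠ 1` only, where `E - z U` is boundedly invertible. -/
noncomputable def generalizedResolvent (ι : H →ₗᵢ[ℂ] K) (U : K ≃ₗᵢ[ℂ] K) (z : ℂ) : H →L[ℂ] H :=
  ContinuousLinearMap.adjoint ι.toContinuousLinearMap ∘L
    Ring.inverse (1 - z • (U.toContinuousLinearEquiv : K →L[ℂ] K)) ∘L ι.toContinuousLinearMap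

/-- `F` corresponds to the operator function `R` by Chumakin's formula: `F ∈ 𝒮(N_0; N_∞)` and
`R_z = [E - z (V ⊕ F(z))]⁻¹` (two-sided inverse) for all `z` in the open unit disc. -/
structure IsChumakinParameter (V : ClosedIsometricOperator H) (R : ℂ → H →L[ℂ] H)
    (F : ℂ → V.defectZero →L[ℂ] V.defectInfty) : Prop where
  schur : IsSchurFunction F
  mul_eq_one : ∀ z : ℂ, ‖z‖ < 1 → R z * (1 - z • V.oplus (F z)) = 1
  eq_one_mul : ∀ z : ℂ, ‖z‖ < 1 → (1 - z • V.oplus (F z)) * R z = 1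

end GeneralizedResolvent

/-- An open arc of the unit circle: the image of a nonempty open interval of the real line under
`t ↦ e^{it}` (equivalently, a nonempty connected relatively open subset of the circle). -/
def IsOpenArc (Δ : Set ℂ) : Prop :=
  ∃ a b : ℝ, a < b ∧ Δ = (fun t : ℝ => Complex.exp (t * Complex.I)) '' Set.Ioo a b

/-- The function `R`, considered on `{|z| ≠ 1}`, has an analytic continuation (as a function with
values in a normed space) to `{|z| < 1} ∪ {|z| > 1} ∪ Δ`. -/
def HasAnalyticContinuation {E : Type*} [NormedAddCommGroup E] [NormedSpace ℂ E]
    (R : ℂ → E) (Δ : Set ℂ) : Prop :=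
  ∃ T : ℂ → E, AnalyticOnNhd ℂ T ({z : ℂ | ‖z‖ < 1} ∪ {z : ℂ | 1 < ‖z‖} ∪ Δ) ∧
    ∀ z : ℂ, ‖z‖ ≠ 1 → T z = R z

end IsometricGaps

/-! The key is the reflection formula `star_generalizedResolvent`. Since 1/z̄ = z on the circle, a
continuation `T` satisfies `T + T* = 1` on Δ. Such a `T` is 1/2 + iA with A self-adjoint, so it is
invertible and `1 - T⁻¹` is unitary. Hence V ⊕ F(z) = z⁻¹(1 - T(z)⁻¹) extends continuously to Δ with
unitary values. These still have the form V ⊕ C, and C is then isometric and onto. Conversely, if C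
is isometric, so is V ⊕ C, and `(1 - λ(V ⊕ C))⁻¹` again has real part 1/2. The boundary values from
inside therefore agree with those of the reflected function outside. The glued function is
continuous across Δ and holomorphic off the circle, hence analytic by a Morera argument. -/

/-! ### Removability of the real line and of the circle for continuous functions. -/

open Complex Set Filter Topology Metric in
theorem Complex.isConservativeOn_of_differentiableAt_of_im_ne_zero
    {E : Type*} [NormedAddCommGroup E] [NormedSpace ℂ E] {f : ℂ → E} {S : Set ℂ}
    (hc : ContinuousOn f S) (hd : ∀ z ∈ S, z.im ≠ 0 → DifferentiableAt ℂ f z) :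
    IsConservativeOn f S := by
  intro z w hzw
  rw [← add_eq_zero_iff_eq_neg, wedgeIntegral_add_wedgeIntegral_eq]
  -- `m` is 0 clamped to the vertical range. Cutting at height `m` gives two rectangles whose
  -- interiors miss the real axis, so Cauchy's theorem applies to each, and the common edge cancels.
  set m : ℝ := max (min z.im w.im) (min 0 (max z.im w.im)) with hm
  have hm1 : m ∈ uIcc z.im w.im := by
    exact ⟨le_max_left _ _, max_le min_le_max (min_le_right _ _)⟩
  have hz1 : uIcc z.im m ⊆ uIcc z.im w.im := uIcc_subset_uIcc left_mem_uIcc hm1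
  have hw1 : uIcc m w.im ⊆ uIcc z.im w.im := uIcc_subset_uIcc hm1 right_mem_uIcc
  have hS : uIcc z.re w.re ×ℂ uIcc z.im w.im ⊆ S := hzw
  have e1 := integral_boundary_rect_eq_zero_of_differentiable_on_off_countable f z ⟨w.re, m⟩ ∅
    countable_empty (hc.mono ((reProdIm_subset_iff'.2 (Or.inl ⟨subset_rfl, hz1⟩)).trans hS)) (by
      rintro x ⟨⟨hx1, hx2⟩, -⟩
      refine hd x (hS ⟨Ioo_subset_Icc_self hx1, hz1 (Ioo_subset_Icc_self hx2)⟩) ?_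
      intro h0
      simp only [mem_preimage, h0, mem_Ioo] at hx2
      grind)
  have e2 := integral_boundary_rect_eq_zero_of_differentiable_on_off_countable f ⟨z.re, m⟩ w ∅
    countable_empty (hc.mono ((reProdIm_subset_iff'.2 (Or.inl ⟨subset_rfl, hw1⟩)).trans hS)) (by
      rintro x ⟨⟨hx1, hx2⟩, -⟩
      refine hd x (hS ⟨Ioo_subset_Icc_self hx1, hw1 (Ioo_subset_Icc_self hx2)⟩) ?_
      intro h0
      simp only [mem_preimage, h0, mem_Ioo] at hx2
      grind)
  have hi : ∀ a ∈ uIcc z.re w.re, ∀ s t : ℝ, uIcc s t ⊆ uIcc z.im w.im →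
      IntervalIntegrable (fun y : ℝ => f (a + y * I)) MeasureTheory.volume s t := by
    intro a ha s t hst
    refine ContinuousOn.intervalIntegrable (hc.comp (by fun_prop) fun y hy => hS ⟨?_, ?_⟩)
    · simpa using ha
    · simpa using hst hy
  rw [← intervalIntegral.integral_add_adjacent_intervals
      (hi w.re right_mem_uIcc _ _ hz1) (hi w.re right_mem_uIcc _ _ hw1),
    ← intervalIntegral.integral_add_adjacent_intervals
      (hi z.re left_mem_uIcc _ _ hz1) (hi z.re left_mem_uIcc _ _ hw1)]
  simp only at e1 e2
  rw [smul_add, smul_add, ← add_zero (0 : E)]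
  nth_rewrite 1 [← e1]
  rw [← e2]
  abel

open Complex Set Filter Topology Metric in
/-- A function that is continuous on an open set and complex differentiable off the unit circle
is analytic. -/
theorem Complex.analyticOnNhd_of_differentiableAt_of_norm_ne_one
    {E : Type*} [NormedAddCommGroup E] [NormedSpace ℂ E] [CompleteSpace E] {f : ℂ → E} {S : Set ℂ}
    (hS : IsOpen S) (hc : ContinuousOn f S)
    (hd : ∀ z ∈ S, ‖z‖ ≠ 1 → DifferentiableAt ℂ f z) : AnalyticOnNhd ℂ f S := by
  refine DifferentiableOn.analyticOnNhd (fun z hz => DifferentiableAt.differentiableWithinAt ?_) hS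
  by_cases hz1 : ‖z‖ ≠ 1
  · exact hd z hz hz1
  push Not at hz1
  have hz0 : z ≠ 0 := by
    rintro rfl
    simp at hz1
  have he : Differentiable ℂ fun w : ℂ => exp (I * w) := by fun_prop
  -- The map w ↦ exp(iw) carries exactly the real line to the circle, which reduces the claim to the
  -- previous lemma.
  set S' : Set ℂ := (fun w : ℂ => exp (I * w)) ⁻¹' S with hS'
  have ho : IsOpen S' := hS.preimage he.continuous
  have hg : DifferentiableOn ℂ (fun w => f (exp (I * w))) S' := by
    refine (isConservativeOn_and_continuousOn_iff_isDifferentiableOn ho).1 ⟨?_, ?_⟩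
    · refine isConservativeOn_of_differentiableAt_of_im_ne_zero
        (hc.comp he.continuous.continuousOn fun _ h => h) fun w hw hw0 => ?_
      refine DifferentiableAt.comp w (hd _ hw ?_) he.differentiableAt
      rw [norm_exp]
      simpa using hw0
    · exact hc.comp he.continuous.continuousOn fun _ h => h
  -- A right inverse of w ↦ exp(iw), holomorphic at v = z whatever z is, because v/z is near 1 and
  -- so away from the cut of `log`.
  have hk : ∀ v : ℂ, v ≠ 0 → exp (I * (-I * log z - I * log (v / z))) = v := by
    intro v hv
    have : I * (-I * log z - I * log (v / z)) = log z + log (v / z) := by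
      linear_combination (-log z - log (v / z)) * I_mul_I
    rw [this, exp_add, exp_log hz0, exp_log (div_ne_zero hv hz0)]
    field_simp
  have hgz : DifferentiableAt ℂ (fun w => f (exp (I * w)))
      (-I * log z - I * log (z / z)) := by
    refine hg.differentiableAt (ho.mem_nhds ?_)
    change exp _ ∈ S
    rwa [hk z hz0]
  have hl : DifferentiableAt ℂ (fun v : ℂ => -I * log z - I * log (v / z)) z := by
    have : z / z ∈ slitPlane := by simp [div_self hz0]
    fun_prop (disch := assumption)
  refine (DifferentiableAt.comp (f := fun v : ℂ => -I * log z - I * log (v / z)) z hgz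
    hl).congr_of_eventuallyEq ?_
  filter_upwards [isOpen_ne.mem_nhds hz0] with v hv
  simp only [Function.comp_apply, hk v hv]

/-! ### Unitaries, and elements with real part 1/2. -/

theorem isUnit_one_sub_smul_of_mem_unitary {A : Type*} [NormedRing A] [StarRing A] [CStarRing A]
    [NormedAlgebra ℂ A] [CompleteSpace A] {u : A} (hu : u ∈ unitary A) {z : ℂ} (hz : ‖z‖ ≠ 1) :
    IsUnit (1 - z • u) := by
  rcases eq_or_ne z 0 with rfl | hz0
  · simp
  have h : z⁻¹ ∉ spectrum ℂ u := fun h => hz (by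
    simpa using spectrum.norm_eq_one_of_unitary hu h)
  rw [spectrum.notMem_iff] at h
  have := h.smul (Units.mk0 z hz0)
  rwa [Units.smul_mk0, smul_sub, Algebra.algebraMap_eq_smul_one, smul_smul,
    mul_inv_cancel₀ hz0, one_smul] at this

theorem star_inverse_one_sub_conj_inv_smul {A : Type*} [NormedRing A] [StarRing A] [CStarRing A]
    [NormedAlgebra ℂ A] [StarModule ℂ A] [CompleteSpace A] {u : A} (hu : u ∈ unitary A) {z : ℂ}
    (hz : ‖z‖ ≠ 1) (hz0 : z ≠ 0) :
    star (Ring.inverse (1 - (star z)⁻¹ • u)) = 1 - Ring.inverse (1 - z • u) := by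
  have h1 := isUnit_one_sub_smul_of_mem_unitary hu hz
  have h2 : IsUnit (1 - (star z)⁻¹ • u) := isUnit_one_sub_smul_of_mem_unitary hu (by
    simpa using hz)
  rw [← Ring.inverse_star]
  -- This factorization, from u*u = 1, reduces the claim to the resolvent at z.
  have h3 : star (1 - (star z)⁻¹ • u) = -(z⁻¹ • star u) * (1 - z • u) := by
    simp [mul_sub, smul_smul, hz0, Unitary.star_mul_self_of_mem hu]
    abel
  refine (h2.star.mul_right_inj).1 ?_
  rw [Ring.mul_inverse_cancel _ h2.star, h3, mul_sub, mul_one, mul_assoc,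
    Ring.mul_inverse_cancel _ h1]
  simp [mul_sub, smul_smul, hz0, Unitary.star_mul_self_of_mem hu]

-- Write t = i(A - i/2) with A = -i(t - 1/2) self-adjoint; the spectrum of A is real, so it omits
-- i/2.
open Complex in
theorem isUnit_of_add_star_eq_one {A : Type*} [CStarAlgebra A] {t : A} (h : t + star t = 1) :
    IsUnit t := by
  have hs : IsSelfAdjoint ((-I) • (t - (2⁻¹ : ℂ) • (1 : A))) := by
    have : star t = 1 - t := eq_sub_of_add_eq' h
    rw [IsSelfAdjoint, star_smul, star_sub, this]
    simp only [star_smul, star_one, star_neg, RCLike.star_def, conj_I, neg_neg, map_inv₀, map_ofNat]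
    module
  have hI : I / 2 ∉ spectrum ℂ ((-I) • (t - (2⁻¹ : ℂ) • (1 : A))) := fun hI => by
    have := congrArg im (hs.mem_spectrum_eq_re hI)
    simp at this
  rw [spectrum.notMem_iff] at hI
  have := hI.smul (Units.mk0 (-I) (by simp))
  rw [Units.smul_mk0, Algebra.algebraMap_eq_smul_one] at this
  convert this using 1
  simp only [smul_sub, smul_smul]
  have e1 : -I * -I = -1 := by simp
  have e2 : -I * (I / 2) = 2⁻¹ := by linear_combination (-1/2 : ℂ) * I_mul_I
  have e3 : -I * (-I * 2⁻¹) = -2⁻¹ := by linear_combination (1/2 : ℂ) * I_mul_I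
  rw [e1, e2, e3]
  module

/-- Multiplying by (1 - w)* on the left and 1 - w on the right leaves (1 - w) + (1 - w)* = (1 -
w)*(1 - w), which is w*w = 1. -/
theorem inverse_one_sub_add_star_eq_one {A : Type*} [Ring A] [StarRing A] {w : A}
    (hw : star w * w = 1) (h : IsUnit (1 - w)) :
    Ring.inverse (1 - w) + star (Ring.inverse (1 - w)) = 1 := by
  rw [← Ring.inverse_star]
  refine (h.star.mul_right_inj).1 ?_
  refine (h.mul_left_inj).1 ?_
  rw [mul_add, Ring.mul_inverse_cancel _ h.star, add_mul, mul_assoc, Ring.inverse_mul_cancel _ h]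
  simp only [star_sub, star_one, mul_sub, sub_mul, mul_one, one_mul, hw]
  abel

/-- A Cayley transform: 1 - t⁻¹ = -t* t⁻¹, and t commutes with t* = 1 - t. -/
theorem one_sub_inverse_mem_unitary {A : Type*} [Ring A] [StarRing A] {t : A}
    (ht : IsUnit t) (h : t + star t = 1) : 1 - Ring.inverse t ∈ unitary A := by
  have e : star t = 1 - t := eq_sub_of_add_eq' h
  have h1 := Ring.mul_inverse_cancel _ ht
  have h2 := Ring.inverse_mul_cancel _ ht
  have h1' : Ring.inverse (star t) * star t = 1 := Ring.inverse_mul_cancel _ ht.star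
  have h2' : star t * Ring.inverse (star t) = 1 := Ring.mul_inverse_cancel _ ht.star
  rw [Unitary.mem_iff, star_sub, star_one, ← Ring.inverse_star]
  constructor
  · refine (ht.star.mul_right_inj).1 ((ht.mul_left_inj).1 ?_)
    rw [← mul_assoc, mul_sub (star t), h2', mul_assoc, sub_mul 1, h2, e]
    noncomm_ring
  · refine (ht.mul_right_inj).1 ((ht.star.mul_left_inj).1 ?_)
    rw [← mul_assoc, mul_sub t, h1, mul_assoc, sub_mul 1, h1', e]
    noncomm_ring

/-! ### The orthogonal sum V ⊕ C and its corner. -/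

namespace IsometricGaps

namespace ClosedIsometricOperator

variable {H : Type*} [NormedAddCommGroup H] [InnerProductSpace ℂ H] [CompleteSpace H]
  (V : ClosedIsometricOperator H)

theorem oplus_apply (C : V.defectZero →L[ℂ] V.defectInfty) (h : H) :
    V.oplus C h = V.op (V.op.domain.orthogonalProjectionOnto h) +
      (C (V.defectZero.orthogonalProjectionOnto h) : H) :=
  rfl

theorem continuous_oplus : Continuous V.oplus := by
  unfold oplus
  fun_prop

theorem oplus_coe_defectZero (C : V.defectZero →L[ℂ] V.defectInfty) (x : V.defectZero) :
    V.oplus C x = C x := by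
  rw [oplus_apply, Submodule.orthogonalProjectionOnto_apply_of_mem_orthogonal x.2,
    Submodule.orthogonalProjectionOnto_mem_subspace_eq_self]
  simp

theorem norm_oplus_apply {C : V.defectZero →L[ℂ] V.defectInfty} (hC : ∀ x, ‖C x‖ = ‖x‖) (h : H) :
    ‖V.oplus C h‖ = ‖h‖ := by
  have ho : inner ℂ (V.op (V.op.domain.orthogonalProjectionOnto h))
      (C (V.defectZero.orthogonalProjectionOnto h) : H) = 0 :=
    Submodule.inner_right_of_mem_orthogonal (LinearMap.mem_range_self V.op.toFun _)
      (C (V.defectZero.orthogonalProjectionOnto h)).2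
  have h1 := norm_add_sq_eq_norm_sq_add_norm_sq_of_inner_eq_zero _ _ ho
  have h2 := Submodule.norm_sq_eq_add_norm_sq_projection h V.op.domain
  rw [← oplus_apply, V.norm_map, ← Submodule.coe_norm, hC] at h1
  rw [← sq_eq_sq₀ (norm_nonneg _) (norm_nonneg _), h2, sq, h1, sq, sq]

theorem surjective_of_surjective_oplus {C : V.defectZero →L[ℂ] V.defectInfty}
    (hC : Function.Surjective (V.oplus C)) : Function.Surjective C := by
  intro y
  obtain ⟨h, hh⟩ := hC y
  refine ⟨V.defectZero.orthogonalProjectionOnto h, ?_⟩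
  have := congrArg V.defectInfty.orthogonalProjectionOnto hh
  have hV : V.defectInfty.orthogonalProjectionOnto
      (V.op (V.op.domain.orthogonalProjectionOnto h)) = 0 :=
    Submodule.orthogonalProjectionOnto_orthogonal_apply_eq_zero
      (LinearMap.mem_range_self V.op.toFun _)
  rwa [oplus_apply, map_add, hV, zero_add,
    Submodule.orthogonalProjectionOnto_mem_subspace_eq_self,
    Submodule.orthogonalProjectionOnto_mem_subspace_eq_self] at this

/-- The corner `N_0 → N_∞` of a bounded operator. -/
noncomputable def corner (W : H →L[ℂ] H) : V.defectZero →L[ℂ] V.defectInfty :=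
  V.defectInfty.orthogonalProjectionOnto ∘L W ∘L V.defectZero.subtypeL

theorem continuous_corner : Continuous V.corner := by
  unfold corner
  fun_prop

/-- With this continuous left inverse, norm limits of operators V ⊕ C are again of that form. -/
theorem corner_oplus (C : V.defectZero →L[ℂ] V.defectInfty) : V.corner (V.oplus C) = C := by
  ext1 x
  simp [corner, oplus_coe_defectZero]

end ClosedIsometricOperator

/-! ### Generalized resolvents off the circle. -/

section Resolvent

variable {H : Type*} [NormedAddCommGroup H] [InnerProductSpace ℂ H] [CompleteSpace H]
  {K : Type*} [NormedAddCommGroup K] [InnerProductSpace ℂ K] [CompleteSpace K]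
  (ι : H →ₗᵢ[ℂ] K) (U : K ≃ₗᵢ[ℂ] K)

theorem coe_mem_unitary : (U.toContinuousLinearEquiv : K →L[ℂ] K) ∈ unitary (K →L[ℂ] K) :=
  (Unitary.linearIsometryEquiv.symm U).2

theorem differentiableAt_generalizedResolvent {z : ℂ} (hz : ‖z‖ ≠ 1) :
    DifferentiableAt ℂ (generalizedResolvent ι U) z := by
  unfold generalizedResolvent
  have h := isUnit_one_sub_smul_of_mem_unitary (coe_mem_unitary U) hz
  have : DifferentiableAt ℂ (fun z : ℂ => Ring.inverse
      (1 - z • (U.toContinuousLinearEquiv : K →L[ℂ] K))) z :=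
    DifferentiableAt.inverse (by fun_prop) h
  fun_prop

/-- The reflection formula `R_{1/z̄}^* = E - R_z`. -/
theorem star_generalizedResolvent {z : ℂ} (hz : ‖z‖ ≠ 1) (hz0 : z ≠ 0) :
    star (generalizedResolvent ι U (star z)⁻¹) = 1 - generalizedResolvent ι U z := by
  have h := star_inverse_one_sub_conj_inv_smul (coe_mem_unitary U) hz hz0
  rw [ContinuousLinearMap.star_eq_adjoint] at h ⊢
  simp only [generalizedResolvent, ContinuousLinearMap.adjoint_comp,
    ContinuousLinearMap.adjoint_adjoint, h]
  ext x
  have hι : ContinuousLinearMap.adjoint ι.toContinuousLinearMap (ι x) = x :=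
    congrArg (fun A : H →L[ℂ] H => A x) ι.adjoint_comp_self
  simp [hι]

end Resolvent

/-! ### Arcs and the circle. -/

theorem IsOpenArc.norm_eq_one {Δ : Set ℂ} (hΔ : IsOpenArc Δ) {z : ℂ} (hz : z ∈ Δ) : ‖z‖ = 1 := by
  obtain ⟨a, b, -, rfl⟩ := hΔ
  obtain ⟨t, -, rfl⟩ := hz
  exact Complex.norm_exp_ofReal_mul_I t

theorem IsOpenArc.isOpen {Δ : Set ℂ} (hΔ : IsOpenArc Δ) :
    IsOpen ({z : ℂ | ‖z‖ < 1} ∪ {z : ℂ | 1 < ‖z‖} ∪ Δ) := by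
  obtain ⟨a, b, -, rfl⟩ := hΔ
  -- The arc is thickened to the open image of a horizontal strip, which adds only points off the
  -- circle.
  have ho : IsOpen (Complex.exp '' (Complex.im ⁻¹' Set.Ioo a b)) :=
    Complex.isOpenMap_exp _ (isOpen_Ioo.preimage Complex.continuous_im)
  convert ((isOpen_lt continuous_norm continuous_const).union
    (isOpen_lt continuous_const continuous_norm)).union ho using 1
  refine subset_antisymm (Set.union_subset_union_right _ ?_)
    (Set.union_subset Set.subset_union_left ?_)
  · rintro _ ⟨t, ht, rfl⟩
    exact ⟨t * Complex.I, by simpa using ht, rfl⟩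
  · rintro _ ⟨w, hw, rfl⟩
    rcases lt_trichotomy w.re 0 with h | h | h
    · exact Or.inl (Or.inl (by simpa [Complex.norm_exp] using h))
    · refine Or.inr ⟨w.im, hw, ?_⟩
      have : w = w.im * Complex.I := Complex.ext (by simp [h]) (by simp)
      exact congrArg Complex.exp this.symm
    · exact Or.inl (Or.inr (by simpa [Complex.norm_exp] using h))

theorem neBot_nhdsWithin_disc {z : ℂ} (hz : ‖z‖ = 1) :
    (nhdsWithin z {z : ℂ | ‖z‖ < 1}).NeBot := by
  have : {z : ℂ | ‖z‖ < 1} = Metric.ball 0 1 := by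
    ext
    simp
  rw [this, ← mem_closure_iff_nhdsWithin_neBot, closure_ball _ one_ne_zero]
  simp [hz]

theorem star_inv_eq_self {z : ℂ} (hz : ‖z‖ = 1) : (star z)⁻¹ = z := by
  have : z * star z = 1 := by
    simp [Complex.mul_conj, Complex.normSq_eq_norm_sq, hz]
  exact (eq_inv_of_mul_eq_one_left this).symm

/-! ### Boundary behaviour and the two implications. -/

section Boundary

variable {H : Type*} [NormedAddCommGroup H] [InnerProductSpace ℂ H] [CompleteSpace H]
  {K : Type*} [NormedAddCommGroup K] [InnerProductSpace ℂ K] [CompleteSpace K]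
  {ι : H →ₗᵢ[ℂ] K} {U : K ≃ₗᵢ[ℂ] K}

open Filter Topology in
/-- On the circle, a continuous extension of a generalized resolvent has real part `1/2`. -/
theorem add_star_eq_one_of_continuousAt {T : ℂ → H →L[ℂ] H}
    (hT : ∀ z : ℂ, ‖z‖ ≠ 1 → T z = generalizedResolvent ι U z) {z : ℂ} (hz : ‖z‖ = 1)
    (hc : ContinuousAt T z) : T z + star (T z) = 1 := by
  have hz0 : z ≠ 0 := by
    rintro rfl
    simp at hz
  have hr : ContinuousAt (fun w : ℂ => T w + star (T (star w)⁻¹)) z := by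
    have hi : ContinuousAt (fun w : ℂ => (star w)⁻¹) z :=
      continuous_star.continuousAt.inv₀ (star_ne_zero.2 hz0)
    have hc' : ContinuousAt T (star z)⁻¹ := by rwa [star_inv_eq_self hz]
    exact hc.add (ContinuousAt.comp (f := fun w : ℂ => (star w)⁻¹) hc' hi).star
  have := neBot_nhdsWithin_disc hz
  have hl : Tendsto (fun w : ℂ => T w + star (T (star w)⁻¹)) (𝓝[{z : ℂ | ‖z‖ < 1}] z)
      (𝓝 (T z + star (T z))) := by
    simpa only [star_inv_eq_self hz] using hr.tendsto.mono_left nhdsWithin_le_nhds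
  refine tendsto_nhds_unique_of_eventuallyEq hl tendsto_const_nhds ?_
  filter_upwards [self_mem_nhdsWithin, nhdsWithin_le_nhds (isOpen_ne.mem_nhds hz0)] with w hw hw0
  have hw1 : ‖w‖ ≠ 1 := ne_of_lt hw
  rw [hT w hw1, hT _ (by simpa using hw1), star_generalizedResolvent ι U hw1 hw0]
  abel

variable {V : ClosedIsometricOperator H} {F : ℂ → V.defectZero →L[ℂ] V.defectInfty}

theorem IsChumakinParameter.inverse_eq {R : ℂ → H →L[ℂ] H} (hF : IsChumakinParameter V R F) {z : ℂ}
    (hz : ‖z‖ < 1) : Ring.inverse (R z) = 1 - z • V.oplus (F z) :=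
  Ring.inverse_unit ⟨R z, _, hF.mul_eq_one z hz, hF.eq_one_mul z hz⟩

theorem IsChumakinParameter.isUnit_one_sub {R : ℂ → H →L[ℂ] H} (hF : IsChumakinParameter V R F)
    {z : ℂ} (hz : ‖z‖ < 1) : IsUnit (1 - z • V.oplus (F z)) :=
  ⟨⟨_, R z, hF.eq_one_mul z hz, hF.mul_eq_one z hz⟩, rfl⟩

theorem IsChumakinParameter.inverse_one_sub {R : ℂ → H →L[ℂ] H} (hF : IsChumakinParameter V R F)
    {z : ℂ} (hz : ‖z‖ < 1) : Ring.inverse (1 - z • V.oplus (F z)) = R z :=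
  Ring.inverse_unit ⟨_, R z, hF.eq_one_mul z hz, hF.mul_eq_one z hz⟩

open Filter Topology in
theorem exists_extension_of_hasAnalyticContinuation
    (hF : IsChumakinParameter V (generalizedResolvent ι U) F) {Δ : Set ℂ} (hΔ : IsOpenArc Δ)
    (h : HasAnalyticContinuation (generalizedResolvent ι U) Δ) :
    ∃ G : ℂ → V.defectZero →L[ℂ] V.defectInfty,
      Set.EqOn G F {z : ℂ | ‖z‖ < 1} ∧
      ContinuousOn G ({z : ℂ | ‖z‖ < 1} ∪ Δ) ∧
      (∀ z ∈ Δ, Isometry (G z) ∧ Function.Surjective (G z)) ∧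
      (∀ z ∈ Δ, Function.Bijective (1 - z • V.oplus (G z) : H →L[ℂ] H)) := by
  obtain ⟨T, hT, hTR⟩ := h
  have hD : ∀ z : ℂ, ‖z‖ < 1 → T z = generalizedResolvent ι U z := fun z hz => hTR z hz.ne
  have hsum : ∀ z ∈ Δ, T z + star (T z) = 1 := fun z hz =>
    add_star_eq_one_of_continuousAt hTR (hΔ.norm_eq_one hz) (hT z (Or.inr hz)).continuousAt
  have hu : ∀ z ∈ Δ, IsUnit (T z) := fun z hz => isUnit_of_add_star_eq_one (hsum z hz)
  have hΔ0 : ∀ z ∈ Δ, z ≠ 0 := by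
    rintro z hz rfl
    simpa using hΔ.norm_eq_one hz
  -- Chumakin's formula solved for V ⊕ F(z), with the continuation in place of the resolvent.
  set W : ℂ → H →L[ℂ] H := fun z => z⁻¹ • (1 - Ring.inverse (T z)) with hW
  have hWD : ∀ z : ℂ, ‖z‖ < 1 → z ≠ 0 → W z = V.oplus (F z) := by
    intro z hz hz0
    simp [hW, hD z hz, hF.inverse_eq hz, smul_smul, hz0]
  have hWc : ∀ z ∈ Δ, ContinuousAt W z := by
    intro z hz
    have h1 : ContinuousAt (fun w => Ring.inverse (T w)) z :=
      ((differentiableAt_inverse (𝕜 := ℂ) (hu z hz)).continuousAt).comp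
        (hT z (Or.inr hz)).continuousAt
    exact (continuousAt_id.inv₀ (hΔ0 z hz)).smul (continuousAt_const.sub h1)
  have hWu : ∀ z ∈ Δ, W z ∈ unitary (H →L[ℂ] H) := by
    intro z hz
    have h1 := one_sub_inverse_mem_unitary (hu z hz) (hsum z hz)
    have h2 : z⁻¹ ∈ unitary ℂ := by
      rw [Unitary.mem_iff_star_mul_self, star_inv₀, star_inv_eq_self (hΔ.norm_eq_one hz),
        mul_inv_cancel₀ (hΔ0 z hz)]
    exact Unitary.smul_mem_of_mem h2 h1
  -- The identity holds in the disc near z and both sides are continuous.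
  have hWo : ∀ z ∈ Δ, V.oplus (V.corner (W z)) = W z := by
    intro z hz
    have := neBot_nhdsWithin_disc (hΔ.norm_eq_one hz)
    have h1 := ((hWc z hz).tendsto.mono_left
      (nhdsWithin_le_nhds (s := {z : ℂ | ‖z‖ < 1})))
    have h2 := ((V.continuous_oplus.comp V.continuous_corner).tendsto (W z)).comp h1
    refine tendsto_nhds_unique_of_eventuallyEq h2 h1 ?_
    filter_upwards [self_mem_nhdsWithin, nhdsWithin_le_nhds (isOpen_ne.mem_nhds (hΔ0 z hz))]
      with w hw hw0
    simp [hWD w hw hw0, V.corner_oplus]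
  classical
  set G : ℂ → V.defectZero →L[ℂ] V.defectInfty :=
    fun z => if ‖z‖ < 1 then F z else V.corner (W z) with hG
  have hGΔ : ∀ z ∈ Δ, G z = V.corner (W z) := fun z hz =>
    if_neg (hΔ.norm_eq_one hz).not_lt
  have hGF : Set.EqOn G F {z : ℂ | ‖z‖ < 1} := fun z hz => if_pos hz
  have hGW : ∀ z ∈ Δ, V.oplus (G z) = W z := fun z hz => by rw [hGΔ z hz, hWo z hz]
  refine ⟨G, hGF, ?_, fun z hz => ⟨?_, ?_⟩, fun z hz => ?_⟩
  · rintro z (hz | hz)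
    · have hopen : IsOpen {z : ℂ | ‖z‖ < 1} := isOpen_lt continuous_norm continuous_const
      exact (((hF.schur.analytic z hz).continuousAt).congr
        (hGF.symm.eventuallyEq_of_mem (hopen.mem_nhds hz))).continuousWithinAt
    · have h1 : ContinuousWithinAt (fun w => V.corner (W w)) ({z : ℂ | ‖z‖ < 1} ∪ Δ) z :=
        (V.continuous_corner.continuousAt.comp (hWc z hz)).continuousWithinAt
      refine h1.congr_of_eventuallyEq ?_ (hGΔ z hz)
      filter_upwards [self_mem_nhdsWithin, nhdsWithin_le_nhds (isOpen_ne.mem_nhds (hΔ0 z hz))]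
        with w hw hw0
      rcases hw with hw | hw
      · rw [hGF hw, hWD w hw hw0, V.corner_oplus]
      · exact hGΔ w hw
  · refine AddMonoidHomClass.isometry_of_norm _ fun x => ?_
    rw [Submodule.coe_norm, ← V.oplus_coe_defectZero, hGW z hz]
    exact (ContinuousLinearMap.norm_map_iff_adjoint_comp_self _).2 (hWu z hz).1 x
  · refine V.surjective_of_surjective_oplus ?_
    rw [hGW z hz]
    intro y
    exact ⟨star (W z) y, congrArg (fun A : H →L[ℂ] H => A y) (hWu z hz).2⟩
  · rw [← ContinuousLinearMap.isUnit_iff_bijective, hGW z hz]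
    have : 1 - z • W z = Ring.inverse (T z) := by simp [hW, smul_smul, hΔ0 z hz]
    rw [this]
    exact (hu z hz).ringInverse

open Filter Topology in
theorem hasAnalyticContinuation_of_extension
    (hF : IsChumakinParameter V (generalizedResolvent ι U) F) {Δ : Set ℂ} (hΔ : IsOpenArc Δ)
    {G : ℂ → V.defectZero →L[ℂ] V.defectInfty} (hGF : Set.EqOn G F {z : ℂ | ‖z‖ < 1})
    (hGc : ContinuousOn G ({z : ℂ | ‖z‖ < 1} ∪ Δ)) (hGi : ∀ z ∈ Δ, Isometry (G z))
    (hGb : ∀ z ∈ Δ, Function.Bijective (1 - z • V.oplus (G z) : H →L[ℂ] H)) :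
    HasAnalyticContinuation (generalizedResolvent ι U) Δ := by
  classical
  set L : ℂ → H →L[ℂ] H := fun z => Ring.inverse (1 - z • V.oplus (G z)) with hL
  have hLu : ∀ z ∈ {z : ℂ | ‖z‖ < 1} ∪ Δ, IsUnit (1 - z • V.oplus (G z)) := by
    rintro z (hz | hz)
    · rw [hGF hz]
      exact hF.isUnit_one_sub hz
    · exact ContinuousLinearMap.isUnit_iff_bijective.2 (hGb z hz)
  have hLc : ContinuousOn L ({z : ℂ | ‖z‖ < 1} ∪ Δ) := by
    intro z hz
    have h1 : ContinuousWithinAt (fun w : ℂ => 1 - w • V.oplus (G w)) ({z : ℂ | ‖z‖ < 1} ∪ Δ) z :=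
      continuousWithinAt_const.sub (continuousWithinAt_id.smul
        (V.continuous_oplus.continuousAt.comp_continuousWithinAt (hGc z hz)))
    exact ((differentiableAt_inverse (𝕜 := ℂ) (hLu z hz)).continuousAt).comp_continuousWithinAt
      (f := fun w : ℂ => 1 - w • V.oplus (G w)) h1
  have hLD : ∀ z : ℂ, ‖z‖ < 1 → L z = generalizedResolvent ι U z := by
    intro z hz
    rw [hL]
    simp only [hGF hz, hF.inverse_one_sub hz]
  have hLs : ∀ z ∈ Δ, L z + star (L z) = 1 := by
    intro z hz
    have hz1 := hΔ.norm_eq_one hz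
    refine inverse_one_sub_add_star_eq_one ?_ (hLu z (Or.inr hz))
    refine (ContinuousLinearMap.norm_map_iff_adjoint_comp_self _).1 fun x => ?_
    rw [smul_apply, norm_smul, hz1, one_mul]
    exact V.norm_oplus_apply (fun y => (AddMonoidHomClass.isometry_iff_norm _).1 (hGi z hz) y) x
  set T : ℂ → H →L[ℂ] H := fun z => if ‖z‖ = 1 then L z else generalizedResolvent ι U z with hTdef
  have hTR : ∀ z : ℂ, ‖z‖ ≠ 1 → T z = generalizedResolvent ι U z := fun z hz => if_neg hz
  have hTΔ : ∀ z ∈ Δ, T z = L z := fun z hz => if_pos (hΔ.norm_eq_one hz)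
  have hTL : Set.EqOn T L ({z : ℂ | ‖z‖ < 1} ∪ Δ) := by
    rintro z (hz | hz)
    · rw [hTR z (ne_of_lt hz), hLD z hz]
    · exact hTΔ z hz
  -- Reflection describes `T` outside through `L` inside; on Δ the two descriptions agree by `hLs`.
  -- This gives continuity from the exterior.
  have hTL' : Set.EqOn T (fun z => 1 - star (L (star z)⁻¹)) ({z : ℂ | 1 < ‖z‖} ∪ Δ) := by
    rintro z (hz | hz)
    · have hz' : 1 < ‖z‖ := hz
      have hz0 : z ≠ 0 := norm_pos_iff.1 (one_pos.trans hz')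
      have : ‖(star z)⁻¹‖ < 1 := by
        rw [norm_inv, norm_star]
        exact inv_lt_one_of_one_lt₀ hz'
      simp only
      rw [hTR z hz'.ne', hLD _ this, star_generalizedResolvent ι U hz'.ne' hz0, sub_sub_cancel]
    · simp only
      rw [hTΔ z hz, star_inv_eq_self (hΔ.norm_eq_one hz)]
      exact eq_sub_of_add_eq (hLs z hz)
  have hd : ∀ z : ℂ, ‖z‖ ≠ 1 → DifferentiableAt ℂ T z := by
    intro z hz
    refine (differentiableAt_generalizedResolvent ι U hz).congr_of_eventuallyEq ?_
    filter_upwards [(isOpen_ne_fun continuous_norm continuous_const).mem_nhds hz] with w hw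
    exact hTR w hw
  refine ⟨T, Complex.analyticOnNhd_of_differentiableAt_of_norm_ne_one hΔ.isOpen ?_
    (fun z _ hz => hd z hz), hTR⟩
  intro z hz
  by_cases hz1 : ‖z‖ ≠ 1
  · exact (hd z hz1).continuousAt.continuousWithinAt
  have hzΔ : z ∈ Δ := hz.resolve_left fun h => hz1 (h.elim (fun h => LT.lt.ne h) fun h => LT.lt.ne' h)
  push Not at hz1
  have hz0 : z ≠ 0 := by
    rintro rfl
    simp at hz1
  have h1 : ContinuousWithinAt T ({z : ℂ | ‖z‖ < 1} ∪ Δ) z :=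
    (hLc z (Or.inr hzΔ)).congr hTL (hTΔ z hzΔ)
  have h2 : ContinuousWithinAt T ({z : ℂ | 1 < ‖z‖} ∪ Δ) z := by
    refine ContinuousWithinAt.congr ?_ hTL' (hTL' (Or.inr hzΔ))
    have hi : ContinuousWithinAt (fun w : ℂ => (star w)⁻¹) ({z : ℂ | 1 < ‖z‖} ∪ Δ) z :=
      (continuous_star.continuousAt.inv₀ (star_ne_zero.2 hz0)).continuousWithinAt
    have hm : Set.MapsTo (fun w : ℂ => (star w)⁻¹) ({z : ℂ | 1 < ‖z‖} ∪ Δ)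
        ({z : ℂ | ‖z‖ < 1} ∪ Δ) := by
      rintro w (hw | hw)
      · refine Or.inl ?_
        change ‖(star w)⁻¹‖ < 1
        rw [norm_inv, norm_star]
        exact inv_lt_one_of_one_lt₀ hw
      · refine Or.inr ?_
        simpa only [star_inv_eq_self (hΔ.norm_eq_one hw)] using hw
    have hLz : ContinuousWithinAt L ({z : ℂ | ‖z‖ < 1} ∪ Δ) (star z)⁻¹ := by
      rw [star_inv_eq_self hz1]
      exact hLc z (Or.inr hzΔ)
    exact continuousWithinAt_const.sub
      (ContinuousWithinAt.comp (f := fun w : ℂ => (star w)⁻¹) hLz hi hm).star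
  refine (h1.union h2).mono ?_
  rintro w ((hw | hw) | hw)
  exacts [Or.inl (Or.inl hw), Or.inr (Or.inl hw), Or.inl (Or.inr hw)]

end Boundary

end IsometricGaps

theorem corollary3p1
    {H : Type*} [NormedAddCommGroup H] [InnerProductSpace ℂ H] [CompleteSpace H]
    (V : IsometricGaps.ClosedIsometricOperator H)
    {K : Type*} [NormedAddCommGroup K] [InnerProductSpace ℂ K] [CompleteSpace K]
    (ι : H →ₗᵢ[ℂ] K) (U : K ≃ₗᵢ[ℂ] K) (hU : IsometricGaps.IsUnitaryExtension V ι U)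
    (F : ℂ → V.defectZero →L[ℂ] V.defectInfty)
    (hF : IsometricGaps.IsChumakinParameter V (IsometricGaps.generalizedResolvent ι U) F)
    (Δ : Set ℂ) (hΔ : IsometricGaps.IsOpenArc Δ) :
    IsometricGaps.HasAnalyticContinuation (IsometricGaps.generalizedResolvent ι U) Δ ↔
      ∃ G : ℂ → V.defectZero →L[ℂ] V.defectInfty,
        Set.EqOn G F {z : ℂ | ‖z‖ < 1} ∧
        ContinuousOn G ({z : ℂ | ‖z‖ < 1} ∪ Δ) ∧
        (∀ z ∈ Δ, Isometry (G z) ∧ Function.Surjective (G z)) ∧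
        (∀ z ∈ Δ, Function.Bijective (1 - z • V.oplus (G z) : H →L[ℂ] H)) := by
  refine ⟨IsometricGaps.exists_extension_of_hasAnalyticContinuation hF hΔ, ?_⟩
  rintro ⟨G, hGF, hGc, hGi, hGb⟩
  exact IsometricGaps.hasAnalyticContinuation_of_extension hF hΔ hGF hGc
    (fun z hz => (hGi z hz).1) hGb
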